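/- All graphs are finite and simple. A \emph{double subdivision} of a graph deletes an edge $uv$, adds two new vertices and joins both of them to $u$ and to $v$. A \emph{generalised triangle} is a graph isomorphic to $K_3$ or obtained from $K_3$ by a finite sequence of double subdivisions; let $\mathcal{K}$ be the class of generalised triangles and $\mathcal{H}$ the class of graphs that have a Hamiltonian path. A \emph{2-cut} of $G$ is a set $\{x,y\}$ of two vertices whose removal increases the number of components. For a component $C$ of $G-\{x,y\}$, the induced subgraph $G[V(C)\cup\{x,y\}]$ is an $\{x,y\}$-\emph{bridge} of $G$; it is \emph{trivial} if it has exactly three vertices. Let $\mathcal{K}_1$ be the class of those $G\in\mathcal{K}$ such that, for every 2-cut $\{x,y\}$ of $G$ and every $\{x,y\}$-bridge $B$, at least one of $x,y$ has degree $1$ in $B$. Let $\mathcal{K}_2$ be the class of those $G\in\mathcal{K}$ such that, for every 2-cut $\{x,y\}$ of $G$, at least one $\{x,y\}$-bridge is trivial. A \emph{Whitney 2-switch} of $G$ chooses a 2-cut $\{x,y\}$ and a component $C$ of $G-\{x,y\}$, and replaces the edges between $C$ and $\{x,y\}$ so that each $z\in V(C)$ becomes adjacent to $x$ (respectively $y$)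 if and only if it was adjacent to $y$ (respectively $x$) in $G$, all other edges being unchanged. Let $P(G,t)$ be the chromatic polynomial of $G$. \textbf{Lemma.} Let $G\in\mathcal{K}_1\cap\mathcal{K}_2$. Then there is a graph $H\in\mathcal{H}\cap\mathcal{K}$ (a generalised triangle with a Hamiltonian path) that is obtained from $G$ by a finite, possibly empty, sequence of Whitney 2-switches, and $P(G,t)=P(H,t)$ for this $H$. In particular, $P(G,t)$ is the chromatic polynomial of some graph in $\mathcal{H}\cap\mathcal{K}$. -/

import Mathlib

open Polynomial

universe u

namespace SimpleGraph

section ChromaticPolynomial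

variable {V : Type u}

/-- A proper colouring with `n` colours is the same as a partition of the vertex set into
independent classes together with an injective labelling of the classes by colours. -/
def coloringEquiv (G : SimpleGraph V) (n : ℕ) :
    G.Coloring (Fin n) ≃
      Σ s : {s : Setoid V // ∀ a b, G.Adj a b → ¬ s a b}, (Quotient s.1 ↪ Fin n) where
  toFun c := ⟨⟨Setoid.ker c, fun _ _ hab h => c.valid hab h⟩,
    ⟨Quotient.lift c (fun _ _ h => h), by
      intro p q
      induction p using Quotient.inductionOn
      induction q using Quotient.inductionOn
      exact fun h => Quotient.sound h⟩⟩
  invFun p := Coloring.mk (fun a => p.2 (Quotient.mk p.1.1 a)) (by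
    intro a b hab h
    exact p.1.2 a b hab (Quotient.exact (p.2.injective h)))
  left_inv c := by ext a; rfl
  right_inv := by
    rintro ⟨⟨s, hs⟩, f⟩
    have key : Setoid.ker (fun a => f (Quotient.mk s a)) = s := by
      ext a b
      rw [Setoid.ker_def]
      exact ⟨fun h => Quotient.exact (f.injective h), fun h => congrArg f (Quotient.sound h)⟩
    refine Sigma.ext (Subtype.ext key) ?_
    have aux : ∀ (t : Setoid V) (h : t = s) (g : Quotient t ↪ Fin n),
        (∀ a, g (Quotient.mk t a) = f (Quotient.mk s a)) → HEq g f := by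
      rintro t rfl g hg
      refine heq_of_eq (DFunLike.ext _ _ fun q => ?_)
      induction q using Quotient.inductionOn
      exact hg _
    exact aux _ key _ fun a => rfl

/-- Among integer polynomials there is exactly one whose value at every natural number `n`
is the number of proper colourings of `G` with `n` colours. -/
theorem existsUnique_chromaticPolynomial [Finite V] (G : SimpleGraph V) :
    ∃! P : ℤ[X], ∀ n : ℕ, P.eval (n : ℤ) = (Nat.card (G.Coloring (Fin n)) : ℤ) := by
  classical
  have : Fintype V := Fintype.ofFinite V
  have : Finite (Setoid V) :=
    Finite.of_injective (fun s : Setoid V => (s.r : V → V → Prop)) fun s t h =>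
      Setoid.ext fun a b => iff_of_eq (congrFun (congrFun h a) b)
  have : Fintype {s : Setoid V // ∀ a b, G.Adj a b → ¬ s a b} := Fintype.ofFinite _
  refine ⟨∑ s : {s : Setoid V // ∀ a b, G.Adj a b → ¬ s a b},
    descPochhammer ℤ (Fintype.card (Quotient s.1)), fun n => ?_, fun Q hQ => ?_⟩
  · rw [Nat.card_congr (coloringEquiv G n), Nat.card_sigma, eval_finsetSum, Nat.cast_sum]
    refine Finset.sum_congr rfl fun s _ => ?_
    rw [descPochhammer_eval_eq_descFactorial, Nat.card_eq_fintype_card,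
      Fintype.card_embedding_eq, Fintype.card_fin]
  · refine Polynomial.eq_of_infinite_eval_eq _ _
      ((Set.infinite_range_of_injective (Nat.cast_injective (R := ℤ))).mono ?_)
    rintro _ ⟨n, rfl⟩
    rw [Set.mem_ofPred_eq, hQ n, Nat.card_congr (coloringEquiv G n), Nat.card_sigma,
      eval_finsetSum, Nat.cast_sum]
    refine Finset.sum_congr rfl fun s _ => ?_
    rw [descPochhammer_eval_eq_descFactorial, Nat.card_eq_fintype_card,
      Fintype.card_embedding_eq, Fintype.card_fin]

/-- The chromatic polynomial `P(G, t)`: the polynomial whose value at every natural number `n`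
is the number of proper colourings of `G` with `n` colours. -/
noncomputable def chromaticPolynomial [Finite V] (G : SimpleGraph V) : ℤ[X] :=
  (existsUnique_chromaticPolynomial G).choose

theorem chromaticPolynomial_eval [Finite V] (G : SimpleGraph V) (n : ℕ) :
    G.chromaticPolynomial.eval (n : ℤ) = (Nat.card (G.Coloring (Fin n)) : ℤ) :=
  (existsUnique_chromaticPolynomial G).choose_spec.1 n

end ChromaticPolynomial

/-- Double subdivision of the edge `uv`: delete `uv`, add two new vertices (the right summand)
and join both of them to `u` and to `v`. -/
def doubleSubdivision {V : Type u} (G : SimpleGraph V) (u v : V) : SimpleGraph (V ⊕ Fin 2) :=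
  (G.deleteEdges {s(u, v)} ⊕g (⊥ : SimpleGraph (Fin 2))) ⊔
    fromRel fun a b => (a = Sum.inl u ∨ a = Sum.inl v) ∧ ∃ i : Fin 2, b = Sum.inr i

/-- Generalised triangles: the graphs obtained, up to isomorphism, from `K₃` by a (possibly
empty) sequence of double subdivisions of edges. -/
inductive IsGeneralisedTriangle : {V : Type u} → SimpleGraph V → Prop
  | triangle {V : Type u} {G : SimpleGraph V} (e : G ≃g completeGraph (Fin 3)) :
      IsGeneralisedTriangle G
  | step {V W : Type u} {G : SimpleGraph V} {H : SimpleGraph W} {u v : V}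
      (hG : IsGeneralisedTriangle G) (huv : G.Adj u v) (e : H ≃g G.doubleSubdivision u v) :
      IsGeneralisedTriangle H

section Cuts

variable {V : Type u} (G : SimpleGraph V)

/-- A cut-set: a set of vertices whose removal increases the number of components. -/
def IsCutSet (S : Set V) : Prop :=
  Nat.card G.ConnectedComponent < Nat.card (G.induce Sᶜ).ConnectedComponent

/-- `{x, y}` is a 2-cut. -/
def IsTwoCut (x y : V) : Prop := x ≠ y ∧ G.IsCutSet {x, y}

/-- The components of `G - {x, y}`. -/
abbrev CutComponent (x y : V) : Type u := (G.induce ({x, y}ᶜ : Set V)).ConnectedComponent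

variable {G}

/-- The vertex set, in `V`, of a component of `G - {x, y}`. -/
def CutComponent.verts {x y : V} (C : G.CutComponent x y) : Set V := Subtype.val '' C.supp

/-- The `{x, y}`-bridge `G[V(C) ∪ {x, y}]` of the component `C` of `G - {x, y}`. -/
def CutComponent.bridge {x y : V} (C : G.CutComponent x y) : G.Subgraph :=
  (⊤ : G.Subgraph).induce (CutComponent.verts C ∪ {x, y})

variable (G)

/-- Property `P₁` of `{x, y}`: in every `{x, y}`-bridge, `x` or `y` has degree 1. -/
def PropertyP₁ (x y : V) : Prop :=
  ∀ C : G.CutComponent x y,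
    ((CutComponent.bridge C).neighborSet x).ncard = 1 ∨
      ((CutComponent.bridge C).neighborSet y).ncard = 1

/-- Property `P₂` of `{x, y}`: some `{x, y}`-bridge is trivial, i.e. has exactly 3 vertices. -/
def PropertyP₂ (x y : V) : Prop :=
  ∃ C : G.CutComponent x y, (CutComponent.bridge C).verts.ncard = 3

/-- The class `K₁`: generalised triangles all of whose 2-cuts have property `P₁`. -/
def MemK₁ : Prop := G.IsGeneralisedTriangle ∧ ∀ x y, G.IsTwoCut x y → G.PropertyP₁ x y

/-- The class `K₂`: generalised triangles all of whose 2-cuts have property `P₂`. -/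
def MemK₂ : Prop := G.IsGeneralisedTriangle ∧ ∀ x y, G.IsTwoCut x y → G.PropertyP₂ x y

variable {G}

/-- The graph obtained from `G` by exchanging the roles of `x` and `y` for the component `C` of
`G - {x, y}`: edges inside `C` and edges of `G - C` are kept, and `z ∈ C` is joined to `x`
(respectively `y`) iff it was joined to `y` (respectively `x`) in `G`. -/
def CutComponent.switch {x y : V} (C : G.CutComponent x y) : SimpleGraph V :=
  fromRel fun a b =>
    (G.Adj a b ∧ (a ∈ CutComponent.verts C ↔ b ∈ CutComponent.verts C)) ∨
    (a ∈ CutComponent.verts C ∧ b = x ∧ G.Adj a y) ∨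
    (a ∈ CutComponent.verts C ∧ b = y ∧ G.Adj a x)

/-- `H` arises from `G` by one Whitney 2-switch. -/
def IsWhitneySwitch (G H : SimpleGraph V) : Prop :=
  ∃ x y : V, G.IsTwoCut x y ∧ ∃ C : G.CutComponent x y, H = CutComponent.switch C

open Classical in
/-- `G` has a Hamiltonian path. -/
def HasHamiltonianPath (G : SimpleGraph V) : Prop :=
  ∃ (a b : V) (p : G.Walk a b), p.IsHamiltonian

end Cuts

end SimpleGraph

/-
The conditions defining the classes `K₁` and `K₂` are inherited backwards along double subdivisions.
So if `G` satisfies them, then so do all the graphs in a construction of `G` from a triangle, and by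
induction along the construction each of these, apart from the triangle, is a caterpillar of
triangles: a double subdivision of a caterpillar violates the conditions unless it prolongs the
caterpillar at one of its ends. A caterpillar is a sequence of triangles, each of which hangs on the
preceding ones in one of two ways, recorded by a Boolean. A Whitney 2-switch negates one Boolean
and leaves the others unchanged, so finitely many switches turn the caterpillar into a zigzag
strip of triangles, which has a Hamiltonian path and is again built by double subdivisions.

A switch of the component `C` of `G - {x, y}` does not change the number of proper colourings:
exchanging the colours of `x` and `y` on `C` turns the colourings of one graph into those of the
other.
-/

namespace GeneralisedTriangle

open SimpleGraph

section Map

variable {V W : Type*} (f : V ↪ W)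

theorem map_sup (G H : SimpleGraph V) : (G ⊔ H).map f = G.map f ⊔ H.map f := by
  ext a b
  simp only [map_adj, sup_adj]
  grind

theorem map_edge (a b : V) : (edge a b).map f = edge (f a) (f b) := by
  ext c d
  simp only [map_adj, edge_adj]
  grind [f.injective.eq_iff]

theorem map_sdiff (G H : SimpleGraph V) : (G \ H).map f = G.map f \ H.map f := by
  ext a b
  simp only [map_adj, sdiff_adj]
  grind [f.injective.eq_iff]

theorem map_iso {G : SimpleGraph V} {H : SimpleGraph W} (e : G ≃g H) : G.map e = H := by
  ext a b
  refine ⟨?_, fun h => ⟨h.ne, e.symm a, e.symm b, e.symm.map_adj_iff.2 h, by simp, by simp⟩⟩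
  rintro ⟨-, a, b, h, rfl, rfl⟩
  exact e.map_adj_iff.2 h

end Map

section Subdivide

variable {V W : Type*}

/-- Double subdivision of the edge `uv` inside a fixed vertex type: the two new vertices are the
given elements `a` and `b`, which are meant to be outside the support of `G`. -/
def subdivide (G : SimpleGraph V) (u v a b : V) : SimpleGraph V :=
  (G \ edge u v) ⊔ (edge u a ⊔ edge v a ⊔ edge u b ⊔ edge v b)

theorem subdivide_congr (G : SimpleGraph V) {u v u' v' : V} (h : s(u, v) = s(u', v')) (a b : V) :
    subdivide G u v a b = subdivide G u' v' a b := by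
  rcases Sym2.eq_iff.1 h with ⟨rfl, rfl⟩ | ⟨rfl, rfl⟩
  · rfl
  · simp only [subdivide, edge_comm u v]
    ac_rfl

theorem map_subdivide (f : V ↪ W) (G : SimpleGraph V) (u v a b : V) :
    (subdivide G u v a b).map f = subdivide (G.map f) (f u) (f v) (f a) (f b) := by
  simp only [subdivide, map_sup, map_sdiff, map_edge]

theorem doubleSubdivision_eq_subdivide (G : SimpleGraph V) (u v : V) :
    G.doubleSubdivision u v =
      subdivide (G.map (Function.Embedding.inl (β := Fin 2))) (.inl u) (.inl v) (.inr 0)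
        (.inr 1) := by
  ext (a | i) (b | j) <;>
    simp only [doubleSubdivision, subdivide, sup_adj, sdiff_adj, edge_adj, fromRel_adj,
      SimpleGraph.sum_adj, deleteEdges_adj, Set.mem_singleton_iff, Sym2.eq_iff, map_adj,
      Function.Embedding.inl_apply, bot_adj]
  · grind [G.ne_of_adj]
  · fin_cases j <;> simp [or_comm]
  · fin_cases i <;> simp [or_comm]
  · fin_cases i <;> fin_cases j <;> simp

end Subdivide

section IsGeneralisedTriangleOn

/-- The edges of `G` form a generalised triangle with vertex set `S`. Working inside a fixed vertex
type makes double subdivision an equality of graphs rather than an isomorphism. -/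
inductive IsGeneralisedTriangleOn {V : Type u} : SimpleGraph V → Set V → Prop
  | triangle {S : Set V} (hS : S.ncard = 3) :
      IsGeneralisedTriangleOn (⊤ : SimpleGraph S).spanningCoe S
  | step {G : SimpleGraph V} {S : Set V} {u v a b : V} (hG : IsGeneralisedTriangleOn G S)
      (huv : G.Adj u v) (ha : a ∉ S) (hb : b ∉ S) (hab : a ≠ b) :
      IsGeneralisedTriangleOn (subdivide G u v a b) (insert a (insert b S))

variable {V W : Type u} {G : SimpleGraph V} {S : Set V}

theorem IsGeneralisedTriangleOn.support_subset (h : IsGeneralisedTriangleOn G S) :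
    G.support ⊆ S := by
  induction h with
  | triangle => exact fun v ⟨w, h⟩ => by simp_all
  | step _ huv _ _ _ ih =>
    rintro c ⟨d, hcd⟩
    simp only [subdivide, sup_adj, sdiff_adj, edge_adj] at hcd
    have key {p q} (h : Adj _ p q) : p ∈ _ := ih ⟨q, h⟩
    grind [huv.symm]

theorem range_sum_fin_two {α β : Type*} (g : α ⊕ Fin 2 → β) :
    Set.range g = insert (g (.inr 0)) (insert (g (.inr 1)) (Set.range (g ∘ .inl))) := by
  ext
  simp only [Set.mem_range, Sum.exists, Fin.exists_fin_two, Set.mem_insert_iff,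
    Function.comp_apply]
  grind

theorem isGeneralisedTriangleOn_map_range (h : G.IsGeneralisedTriangle) (f : V ↪ W) :
    IsGeneralisedTriangleOn (G.map f) (Set.range f) := by
  induction h generalizing W with
  | @triangle V G e =>
    have hG : G.map f = (⊤ : SimpleGraph (Set.range f)).spanningCoe := by
      ext a b
      have hadj (c d) : G.Adj c d ↔ c ≠ d := by simp [← e.map_adj_iff]
      simp only [map_adj, hadj]
      aesop
    rw [hG]
    refine .triangle ?_
    rw [← Set.image_univ, Set.ncard_image_of_injective _ f.injective, Set.ncard_univ,
      Nat.card_congr e.toEquiv, Nat.card_fin]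
  | @step V V' G H u v _ huv e ih =>
    let g : V ⊕ Fin 2 ↪ W := e.symm.toEquiv.toEmbedding.trans f
    have hmap : H.map f = (G.doubleSubdivision u v).map g := by
      rw [← map_iso e.symm, SimpleGraph.map_map]
      rfl
    have hrange : Set.range f = Set.range g := (e.symm.toEquiv.surjective.range_comp f).symm
    have hG' : (G.map (Function.Embedding.inl (β := Fin 2))).map g =
        G.map (Function.Embedding.inl.trans g) := SimpleGraph.map_map ..
    rw [hmap, hrange, range_sum_fin_two, doubleSubdivision_eq_subdivide, map_subdivide, hG']
    exact .step (ih _) ((map_adj ..).2 ⟨u, v, huv, rfl, rfl⟩) (by simp) (by simp) (by simp)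

theorem IsGeneralisedTriangleOn.exists_embedding (h : IsGeneralisedTriangleOn G S) :
    ∃ (V₀ : Type u) (G₀ : SimpleGraph V₀) (f : V₀ ↪ V), G₀.IsGeneralisedTriangle ∧
      G₀.map f = G ∧ Set.range f = S := by
  induction h with
  | @triangle S hS =>
    have : Finite S := Set.finite_of_ncard_ne_zero (by omega)
    exact ⟨S, ⊤, .subtype _, .triangle (Iso.completeGraph (Finite.equivFinOfCardEq hS)), rfl,
      Subtype.range_coe⟩
  | @step G S u v a b hG huv ha hb hab ih =>
    obtain ⟨V₀, G₀, f, hG₀, rfl, rfl⟩ := ih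
    obtain ⟨u, v, huv', rfl, rfl⟩ := (map_adj ..).1 huv
    have hpair : Function.Injective ![a, b] := by
      simpa [Function.Injective, Fin.forall_fin_two, eq_comm] using hab
    let g : V₀ ⊕ Fin 2 ↪ V := ⟨Sum.elim f ![a, b], f.injective.sumElim hpair (by
      simp_all [Fin.forall_fin_two])⟩
    refine ⟨V₀ ⊕ Fin 2, G₀.doubleSubdivision u v, g, .step hG₀ huv' Iso.refl, ?_, ?_⟩
    · rw [doubleSubdivision_eq_subdivide, map_subdivide, SimpleGraph.map_map]
      rfl
    · exact range_sum_fin_two g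

theorem isGeneralisedTriangle_of_iso {H : SimpleGraph W} (h : G.IsGeneralisedTriangle)
    (e : H ≃g G) : H.IsGeneralisedTriangle := by
  cases h with
  | triangle e' => exact .triangle (e.trans e')
  | step h huv e' => exact .step h huv (e.trans e')

theorem isGeneralisedTriangleOn_univ_iff :
    IsGeneralisedTriangleOn G Set.univ ↔ G.IsGeneralisedTriangle := by
  constructor
  · intro h
    obtain ⟨V₀, G₀, f, hG₀, rfl, hf⟩ := h.exists_embedding
    let e : V₀ ≃ V := Equiv.ofBijective f ⟨f.injective, Set.range_eq_univ.1 hf⟩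
    exact isGeneralisedTriangle_of_iso hG₀ (Iso.map e G₀).symm
  · intro h
    have hmap := isGeneralisedTriangleOn_map_range h (.refl V)
    rwa [Function.Embedding.coe_refl, SimpleGraph.map_id, Set.range_id] at hmap

end IsGeneralisedTriangleOn

section Split

variable {V : Type*} {G H : SimpleGraph V} {x y : V} {A : Set V}

/-- `A` is one of the parts cut off by `{x, y}`: a connected set disjoint from `{x, y}` whose only
neighbours outside `A` are `x` and `y`, both of which do occur. -/
structure IsSide (G : SimpleGraph V) (x y : V) (A : Set V) : Prop where
  left_notMem : x ∉ A
  right_notMem : y ∉ A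
  connected : (G.induce A).Connected
  mem_or_eq : ∀ ⦃a b⦄, a ∈ A → G.Adj a b → b ∈ A ∨ b = x ∨ b = y
  exists_adj_left : ∃ a ∈ A, G.Adj x a
  exists_adj_right : ∃ a ∈ A, G.Adj y a

/-- The removal of the non-adjacent pair `{x, y}` splits the set `S`, which plays the role of the
vertex set of `G`, into the disjoint sides `A i`. -/
structure IsSplit {ι : Type*} (G : SimpleGraph V) (S : Set V) (x y : V) (A : ι → Set V) :
    Prop where
  ne : x ≠ y
  not_adj : ¬ G.Adj x y
  side : ∀ i, IsSide G x y (A i)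
  disjoint : Pairwise (Function.onFun Disjoint A)
  cover : {x, y} ∪ ⋃ i, A i = S

namespace IsSide

theorem congr (h : IsSide G x y A) (hGH : ∀ a ∈ A, ∀ b, H.Adj a b ↔ G.Adj a b) :
    IsSide H x y A where
  left_notMem := h.left_notMem
  right_notMem := h.right_notMem
  connected := by
    have hind : H.induce A = G.induce A := by
      ext a b
      exact hGH a a.2 b
    exact hind ▸ h.connected
  mem_or_eq a b ha hab := h.mem_or_eq ha ((hGH a ha b).1 hab)
  exists_adj_left := by
    obtain ⟨a, ha, hxa⟩ := h.exists_adj_left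
    exact ⟨a, ha, ((hGH a ha x).2 hxa.symm).symm⟩
  exists_adj_right := by
    obtain ⟨a, ha, hya⟩ := h.exists_adj_right
    exact ⟨a, ha, ((hGH a ha y).2 hya.symm).symm⟩

end IsSide

variable {u v a b : V}

theorem subdivide_adj_of_adj {c d : V} (h : G.Adj c d) (hne : s(c, d) ≠ s(u, v)) :
    (subdivide G u v a b).Adj c d := by
  simp only [subdivide, sup_adj, sdiff_adj, edge_adj]
  grind

theorem subdivide_adj_of_mem {c : V} (hc : c = u ∨ c = v) (hca : c ≠ a) (hcb : c ≠ b) :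
    (subdivide G u v a b).Adj c a ∧ (subdivide G u v a b).Adj c b := by
  simp only [subdivide, sup_adj, sdiff_adj, edge_adj]
  grind

theorem connected_induce_subdivide (h : (G.induce A).Connected) (hu : u ∈ A) (ha : a ∉ A)
    (hb : b ∉ A) : ((subdivide G u v a b).induce (insert a (insert b A))).Connected := by
  set H := (subdivide G u v a b).induce (insert a (insert b A))
  have hadj {c : V} (hc : c ∈ A) (hcuv : c = u ∨ c = v) :=
    subdivide_adj_of_mem (G := G) (a := a) (b := b) hcuv (by grind) (by grind)
  let ι (c : A) : ↑(insert a (insert b A)) := ⟨c, .inr (.inr c.2)⟩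
  have hstep (c d : A) (hcd : (G.induce A).Adj c d) : H.Reachable (ι c) (ι d) := by
    by_cases he : s(c.1, d.1) = s(u, v)
    · have hca := hadj c.2 (by grind)
      have hda := hadj d.2 (by grind)
      let a' : ↑(insert a (insert b A)) := ⟨a, .inl rfl⟩
      have hca : H.Adj (ι c) a' := hca.1
      have hda : H.Adj (ι d) a' := hda.1
      exact hca.reachable.trans hda.symm.reachable
    · exact Adj.reachable (subdivide_adj_of_adj (G := G) hcd he)
  have hreach (c d : A) : H.Reachable (ι c) (ι d) := by
    have hcd := h.preconnected c d
    rw [reachable_iff_reflTransGen] at hcd ⊢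
    exact hcd.lift' ι fun c d h => (reachable_iff_reflTransGen ..).1 (hstep c d h)
  refine (connected_iff_exists_forall_reachable _).2 ⟨ι ⟨u, hu⟩, ?_⟩
  have hua := hadj hu (.inl rfl)
  rintro ⟨c, rfl | rfl | hc⟩
  · exact Adj.reachable (G := H) (u := ι ⟨u, hu⟩) hua.1
  · exact Adj.reachable (G := H) (u := ι ⟨u, hu⟩) hua.2
  · exact hreach ⟨u, hu⟩ ⟨c, hc⟩

namespace IsSide

theorem insert_insert (h : IsSide G x y A) (huv : G.Adj u v) (hu : u ∈ A) (ha : a ∉ A)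
    (hb : b ∉ A) (haG : a ∉ G.support) (hbG : b ∉ G.support) :
    IsSide (subdivide G u v a b) x y (insert a (insert b A)) := by
  obtain ⟨cx, hcx, hx⟩ := h.exists_adj_left
  obtain ⟨cy, hcy, hy⟩ := h.exists_adj_right
  have hv := h.mem_or_eq hu huv
  have hxA := h.left_notMem
  have hyA := h.right_notMem
  have hxG : x ∈ G.support := ⟨cx, hx⟩
  have hyG : y ∈ G.support := ⟨cy, hy⟩
  have hva : v ≠ a := by rintro rfl; exact haG ⟨u, huv.symm⟩
  have hvb : v ≠ b := by rintro rfl; exact hbG ⟨u, huv.symm⟩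
  have hadj {z c : V} (hz : z ∉ A) (hc : c ∈ A) (hzc : G.Adj z c) :
      ∃ c ∈ insert a (insert b A), (subdivide G u v a b).Adj z c := by
    by_cases he : s(z, c) = s(u, v)
    · obtain rfl : z = v := by grind
      exact ⟨a, .inl rfl, (subdivide_adj_of_mem (.inr rfl) hva hvb).1⟩
    · exact ⟨c, .inr (.inr hc), subdivide_adj_of_adj hzc he⟩
  refine ⟨by grind, by grind, connected_induce_subdivide h.connected hu ha hb, ?_, ?_, ?_⟩
  · intro c d hc hcd
    simp only [subdivide, sup_adj, sdiff_adj, edge_adj] at hcd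
    have hcG : c ∈ A ∨ c ∉ G.support := by grind
    have hG : G.Adj c d → d ∈ A ∨ d = x ∨ d = y := fun hcd =>
      h.mem_or_eq (hcG.resolve_right fun hc => hc ⟨d, hcd⟩) hcd
    grind
  · exact hadj hxA hcx hx
  · exact hadj hyA hcy hy

end IsSide

namespace IsSplit

variable {ι : Type*} {S : Set V} {A : ι → Set V}

theorem subset (h : IsSplit G S x y A) (i : ι) : A i ⊆ S :=
  (Set.subset_iUnion A i).trans (Set.subset_union_right.trans h.cover.subset)

theorem eq_or_eq_or_exists_mem (h : IsSplit G S x y A) {v : V} (hv : v ∈ S) :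
    v = x ∨ v = y ∨ ∃ i, v ∈ A i := by
  simpa [← h.cover, or_assoc] using hv

theorem eq_of_mem (h : IsSplit G S x y A) {v : V} {i j : ι} (hi : v ∈ A i) (hj : v ∈ A j) :
    i = j := by
  by_contra hij
  exact Set.disjoint_left.1 (h.disjoint hij) hi hj

theorem exists_mem_of_adj (h : IsSplit G S x y A) (hS : G.support ⊆ S) (huv : G.Adj u v) :
    ∃ i, u ∈ A i ∨ v ∈ A i := by
  have hxy := h.not_adj
  have hyx := fun hyx : G.Adj y x => hxy hyx.symm
  have hu := h.eq_or_eq_or_exists_mem (hS ⟨v, huv⟩)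
  have hv := h.eq_or_eq_or_exists_mem (hS ⟨u, huv.symm⟩)
  grind [huv.ne]

theorem update_insert [DecidableEq ι] (h : IsSplit G S x y A) (hS : G.support ⊆ S)
    (huv : G.Adj u v) {i : ι} (hi : u ∈ A i ∨ v ∈ A i) (ha : a ∉ S) (hb : b ∉ S) :
    IsSplit (subdivide G u v a b) (insert a (insert b S)) x y
      (Function.update A i (insert a (insert b (A i)))) := by
  wlog hu : u ∈ A i generalizing u v
  · rw [subdivide_congr G Sym2.eq_swap]
    exact this huv.symm hi.symm (hi.resolve_left hu)
  have hAS := h.subset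
  have hxS : x ∈ S := h.cover.subset (by simp)
  have hyS : y ∈ S := h.cover.subset (by simp)
  have hv : v ∈ A i ∨ v = x ∨ v = y := (h.side i).mem_or_eq hu huv
  have hx := (h.side i).left_notMem
  have hy := (h.side i).right_notMem
  have hne : ∀ j ≠ i, ∀ c ∈ A j, c ≠ u ∧ c ≠ v ∧ c ≠ a ∧ c ≠ b := by
    intro j hj c hc
    have := (h.side j).left_notMem
    have := (h.side j).right_notMem
    have := fun hci => hj (h.eq_of_mem hc hci)
    grind
  refine ⟨h.ne, ?_, fun j => ?_, ?_, ?_⟩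
  · have := h.not_adj
    simp only [subdivide, sup_adj, sdiff_adj, edge_adj]
    grind
  · rcases eq_or_ne j i with rfl | hj
    · rw [Function.update_self]
      exact (h.side j).insert_insert huv hu (fun h => ha (hAS j h)) (fun h => hb (hAS j h))
        (fun h => ha (hS h)) fun h => hb (hS h)
    · rw [Function.update_of_ne hj]
      refine (h.side j).congr fun c hc d => ?_
      have := hne j hj c hc
      simp only [subdivide, sup_adj, sdiff_adj, edge_adj]
      grind
  · intro j k hjk
    have := h.disjoint hjk
    simp only [Function.onFun, Set.disjoint_left, Function.update_apply] at this ⊢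
    grind
  · ext c
    simp only [← h.cover, Set.mem_union, Set.mem_iUnion, Set.mem_insert_iff, Function.update_apply]
    grind

end IsSplit

/-- Every splitting of `(G, S)` into three sides satisfies the local conditions defining the classes
`K₁` and `K₂`: each side contains a unique neighbour of `x` or of `y`, and some side is a single
vertex. -/
def HasThinSplits (G : SimpleGraph V) (S : Set V) : Prop :=
  ∀ ⦃x y : V⦄ ⦃A : Fin 3 → Set V⦄, IsSplit G S x y A →
    (∀ i, {w ∈ A i | G.Adj x w}.Subsingleton ∨ {w ∈ A i | G.Adj y w}.Subsingleton) ∧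
      ∃ i, (A i).Subsingleton

theorem HasThinSplits.of_subdivide {S : Set V}
    (h : HasThinSplits (subdivide G u v a b) (insert a (insert b S))) (hS : G.support ⊆ S)
    (huv : G.Adj u v) (ha : a ∉ S) (hb : b ∉ S) (hab : a ≠ b) : HasThinSplits G S := by
  intro x y A hA
  obtain ⟨i, hi⟩ := hA.exists_mem_of_adj hS huv
  obtain ⟨hdeg, j, hj⟩ := h (hA.update_insert hS huv hi ha hb)
  have hsub (k) : A k ⊆ Function.update A i (insert a (insert b (A i))) k := by
    rcases eq_or_ne k i with rfl | hk
    · simp only [Function.update_self]; grind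
    · rw [Function.update_of_ne hk]
  have hdeg' {z k} (hz : ∀ i, z ∉ A i)
      (hk : {w ∈ Function.update A i (insert a (insert b (A i))) k |
        (subdivide G u v a b).Adj z w}.Subsingleton) : {w ∈ A k | G.Adj z w}.Subsingleton := by
    have hne {w} (hw : w ∈ A k) : s(z, w) ≠ s(u, v) := by
      intro he
      obtain rfl : k = i := by
        rcases hi with hi | hi <;> exact hA.eq_of_mem hw (by grind)
      have hz : z = u ∨ z = v := by grind
      have hzS : z ∈ S := hz.elim (fun h => hS ⟨v, h ▸ huv⟩) (fun h => hS ⟨u, h ▸ huv.symm⟩)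
      have hadj := subdivide_adj_of_mem (G := G) (a := a) (b := b) hz (by grind) (by grind)
      exact hab (hk ⟨by simp, hadj.1⟩ ⟨by simp, hadj.2⟩)
    exact fun p hp q hq => hk ⟨hsub k hp.1, subdivide_adj_of_adj hp.2 (hne hp.1)⟩
      ⟨hsub k hq.1, subdivide_adj_of_adj hq.2 (hne hq.1)⟩
  exact ⟨fun k => (hdeg k).imp (hdeg' fun i => (hA.side i).left_notMem)
    (hdeg' fun i => (hA.side i).right_notMem), j, hj.anti (hsub j)⟩

end Split

section Components

variable {V : Type u} {G : SimpleGraph V} {x y : V}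

namespace CutComponent

theorem mem_verts_iff {C : G.CutComponent x y} {v : V} (hv : v ∈ ({x, y}ᶜ : Set V)) :
    v ∈ CutComponent.verts C ↔ ⟨v, hv⟩ ∈ C.supp :=
  Subtype.val_injective.mem_set_image (a := ⟨v, hv⟩)

theorem left_notMem_verts (C : G.CutComponent x y) : x ∉ CutComponent.verts C := by
  rintro ⟨v, -, hv⟩
  exact v.2 (.inl hv)

theorem right_notMem_verts (C : G.CutComponent x y) : y ∉ CutComponent.verts C := by
  rintro ⟨v, -, hv⟩
  exact v.2 (.inr hv)

theorem mem_verts_of_adj {C : G.CutComponent x y} {a b : V} (ha : a ∈ CutComponent.verts C)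
    (hab : G.Adj a b) : b ∈ CutComponent.verts C ∨ b = x ∨ b = y := by
  by_cases hb : b ∈ ({x, y} : Set V)
  · exact .inr hb
  · obtain ⟨a, ha, rfl⟩ := ha
    exact .inl ⟨⟨b, hb⟩, C.mem_supp_of_adj_mem_supp ha hab, rfl⟩

theorem eq_of_mem_verts {C D : G.CutComponent x y} {v : V} (hC : v ∈ CutComponent.verts C)
    (hD : v ∈ CutComponent.verts D) : C = D := by
  obtain ⟨v, hv, rfl⟩ := hC
  exact ConnectedComponent.eq_of_common_vertex hv ((mem_verts_iff v.2).1 hD)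

end CutComponent

theorem IsSide.exists_verts_eq {A : Set V} (h : IsSide G x y A) :
    ∃ C : G.CutComponent x y, CutComponent.verts C = A := by
  have hA : A ⊆ ({x, y}ᶜ : Set V) := by
    have := h.left_notMem
    have := h.right_notMem
    intro a ha
    simp only [Set.mem_compl_iff, Set.mem_insert_iff, Set.mem_singleton_iff]
    grind
  obtain ⟨a⟩ := h.connected.nonempty
  let C : G.CutComponent x y := (G.induce {x, y}ᶜ).connectedComponentMk ⟨a, hA a.2⟩
  refine ⟨C, Set.Subset.antisymm ?_ fun b hb => ?_⟩
  · rintro _ ⟨b, hb, rfl⟩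
    have hab := (reachable_iff_reflTransGen ..).1 (ConnectedComponent.exact hb).symm
    clear hb
    induction hab with
    | refl => exact a.2
    | @tail c d _ hcd ih => exact (h.mem_or_eq ih hcd).resolve_right d.2
  · rw [CutComponent.mem_verts_iff (hA hb)]
    exact ConnectedComponent.sound
      ((h.connected.preconnected ⟨b, hb⟩ a).map (induceHomOfLE G hA).toHom)

namespace IsSplit

variable {ι : Type*} {A : ι → Set V}

theorem exists_eq_verts (h : IsSplit G Set.univ x y A) (C : G.CutComponent x y) :
    ∃ i, CutComponent.verts C = A i := by
  obtain ⟨⟨v, hv⟩, hvC⟩ := C.nonempty_supp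
  obtain ⟨i, hi⟩ : ∃ i, v ∈ A i := by
    have := h.eq_or_eq_or_exists_mem (Set.mem_univ v)
    simp only [Set.mem_compl_iff, Set.mem_insert_iff, Set.mem_singleton_iff] at hv
    grind
  obtain ⟨D, hD⟩ := (h.side i).exists_verts_eq
  have hCD : C = D := CutComponent.eq_of_mem_verts ⟨⟨v, hv⟩, hvC, rfl⟩ (hD ▸ hi)
  exact ⟨i, hCD ▸ hD⟩

theorem preconnected [Nonempty ι] (h : IsSplit G Set.univ x y A) : G.Preconnected := by
  have hside (i) (a b : V) (ha : a ∈ A i) (hb : b ∈ A i) : G.Reachable a b :=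
    ((h.side i).connected.preconnected ⟨a, ha⟩ ⟨b, hb⟩).map (Embedding.induce (A i)).toHom
  have hleft (i) (a : V) (ha : a ∈ A i) : G.Reachable a x := by
    obtain ⟨b, hb, hxb⟩ := (h.side i).exists_adj_left
    exact (hside i a b ha hb).trans hxb.symm.reachable
  have hx (v : V) : G.Reachable v x := by
    rcases h.eq_or_eq_or_exists_mem (Set.mem_univ v) with rfl | rfl | ⟨i, hi⟩
    · rfl
    · obtain ⟨i⟩ := ‹Nonempty ι›
      obtain ⟨b, hb, hvb⟩ := (h.side i).exists_adj_right
      exact hvb.reachable.trans (hleft i b hb)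
    · exact hleft i v hi
  exact fun v w => (hx v).trans (hx w).symm

theorem isTwoCut [Finite V] [Nontrivial ι] (h : IsSplit G Set.univ x y A) : G.IsTwoCut x y := by
  refine ⟨h.ne, ?_⟩
  have hone : Nat.card G.ConnectedComponent ≤ 1 :=
    Finite.card_le_one_iff_subsingleton.2 h.preconnected.subsingleton_connectedComponent
  obtain ⟨i, j, hij⟩ := exists_pair_ne ι
  obtain ⟨C, hC⟩ := (h.side i).exists_verts_eq
  obtain ⟨D, hD⟩ := (h.side j).exists_verts_eq
  obtain ⟨v⟩ := (h.side i).connected.nonempty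
  have hCD : C ≠ D := by
    rintro rfl
    exact hij (h.eq_of_mem v.2 (hC.symm.trans hD ▸ v.2))
  have : Nontrivial (G.CutComponent x y) := ⟨C, D, hCD⟩
  exact hone.trans_lt Finite.one_lt_card

end IsSplit

theorem hasThinSplits_univ [Finite V] (h₁ : G.MemK₁) (h₂ : G.MemK₂) :
    HasThinSplits G Set.univ := by
  intro x y A h
  refine ⟨fun i => ?_, ?_⟩
  · obtain ⟨C, hC⟩ := (h.side i).exists_verts_eq
    have hsub {z} (hz : z = x ∨ z = y) (h1 : ((CutComponent.bridge C).neighborSet z).ncard = 1) :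
        {w ∈ A i | G.Adj z w}.Subsingleton := by
      obtain ⟨c, hc⟩ := Set.ncard_eq_one.1 h1
      refine (Set.subsingleton_singleton (a := c)).anti ?_
      rw [← hc]
      rintro w ⟨hw, hzw⟩
      exact ⟨.inr hz, .inl (hC ▸ hw), hzw⟩
    exact (h₁.2 x y h.isTwoCut C).imp (hsub (.inl rfl)) (hsub (.inr rfl))
  · obtain ⟨C, hC⟩ := h₂.2 x y h.isTwoCut
    obtain ⟨i, hi⟩ := h.exists_eq_verts C
    have hdisj : Disjoint (A i) {x, y} := by
      simp [(h.side i).left_notMem, (h.side i).right_notMem]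
    have hcard : (A i ∪ {x, y}).ncard = 3 := hi ▸ hC
    rw [Set.ncard_union_eq hdisj, Set.ncard_pair h.ne] at hcard
    exact ⟨i, Set.ncard_le_one_iff_subsingleton.1 (by omega)⟩

end Components

/-- A branch of a caterpillar of triangles, to be attached to two poles `p`, `q`. A leaf is a single
vertex joined to both poles. A node joins `z` to the first pole `p` and `n` to the second pole `q`
(the other way round if the Boolean is `false`), joins `n` to `z`, and attaches the remaining branch
to `z` and to the pole that is adjacent to `n`. -/
inductive Branch (V : Type*)
  | leaf (e : V) : Branch V
  | node (b : Bool) (z n : V) (t : Branch V) : Branch V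

namespace Branch

variable {V : Type*}

/-- The vertices of a branch, without the poles. -/
def verts : Branch V → Multiset V
  | leaf e => {e}
  | node _ z n t => z ::ₘ n ::ₘ t.verts

/-- The graph of a branch attached to the poles `p` and `q`. -/
def graph : Branch V → V → V → SimpleGraph V
  | leaf e, p, q => edge p e ⊔ edge q e
  | node true z n t, p, q => edge p z ⊔ edge q n ⊔ edge n z ⊔ t.graph q z
  | node false z n t, p, q => edge q z ⊔ edge p n ⊔ edge n z ⊔ t.graph p z

/-- The branch with its first Boolean negated: attaching it amounts to exchanging the poles. -/
def flip : Branch V → Branch V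
  | leaf e => leaf e
  | node b z n t => node (!b) z n t

/-- All Booleans of the branch are `true`. Then each triangle hangs on the pole that is not used by
the preceding one, and the triangles form a strip. -/
def IsZigzag : Branch V → Prop
  | leaf _ => True
  | node b _ _ t => b = true ∧ t.IsZigzag

variable {t : Branch V} {p q a b : V}

@[simp] theorem verts_flip (t : Branch V) : t.flip.verts = t.verts := by
  cases t <;> rfl

@[simp] theorem graph_flip (t : Branch V) (p q : V) : t.flip.graph p q = t.graph q p := by
  rcases t with e | ⟨_ | _, z, n, t⟩
  · exact sup_comm ..
  all_goals rfl

theorem map_graph_of_fixed {f : V ↪ V} (hf : ∀ v ∈ t.verts, f v = v) (p q : V) :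
    (t.graph p q).map f = t.graph (f p) (f q) := by
  induction t generalizing p q with
  | leaf e =>
    rw [verts] at hf
    simp only [graph, map_sup, map_edge, hf e (Multiset.mem_singleton_self e)]
  | node b z n t ih =>
    simp only [verts, Multiset.mem_cons, forall_eq_or_imp] at hf
    obtain ⟨hz, hn, ht⟩ := hf
    cases b <;> simp only [graph, map_sup, map_edge, hz, hn, ih ht]

theorem map_swap_graph [DecidableEq V] (h : (p ::ₘ q ::ₘ t.verts).Nodup) :
    (t.graph p q).map (Equiv.swap p q) = t.flip.graph p q := by
  simp only [Multiset.nodup_cons, Multiset.mem_cons] at h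
  have hfix (v) (hv : v ∈ t.verts) : Equiv.swap p q v = v :=
    Equiv.swap_apply_of_ne_of_ne (by grind) (by grind)
  have := map_graph_of_fixed (f := (Equiv.swap p q).toEmbedding) hfix p q
  simpa using this

theorem mem_of_adj (h : (t.graph p q).Adj a b) :
    (a ∈ t.verts ∧ (b ∈ t.verts ∨ b = p ∨ b = q)) ∨
      (b ∈ t.verts ∧ (a ∈ t.verts ∨ a = p ∨ a = q)) := by
  induction t generalizing p q with
  | leaf e => simp only [graph, sup_adj, edge_adj, verts, Multiset.mem_singleton] at h ⊢; grind
  | node c z n t ih =>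
    cases c <;> simp only [graph, sup_adj, edge_adj, verts, Multiset.mem_cons] at h ⊢ <;> grind

theorem exists_adj_left (h : (p ::ₘ q ::ₘ t.verts).Nodup) :
    ∃ v ∈ t.verts, (t.graph p q).Adj p v := by
  rcases t with e | ⟨_ | _, z, n, t⟩ <;>
    simp only [graph, sup_adj, edge_adj, verts, Multiset.nodup_cons, Multiset.mem_cons,
      Multiset.mem_singleton] at h ⊢ <;>
    grind

theorem exists_adj_right (h : (p ::ₘ q ::ₘ t.verts).Nodup) :
    ∃ v ∈ t.verts, (t.graph p q).Adj q v := by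
  obtain ⟨v, hv, hqv⟩ := exists_adj_left (t := t.flip) (p := q) (q := p) (by
    rwa [verts_flip, Multiset.cons_swap])
  exact ⟨v, t.verts_flip ▸ hv, t.graph_flip q p ▸ hqv⟩

theorem connected_induce {G : SimpleGraph V} (h : (p ::ₘ q ::ₘ t.verts).Nodup)
    (hG : t.graph p q ≤ G) : (G.induce {v | v ∈ t.verts}).Connected := by
  induction t generalizing p q with
  | leaf e =>
    have he : {v | v ∈ (leaf e).verts} = {e} := by ext; simp [verts]
    rw [he]
    exact Connected.of_subsingleton
  | node c z n t ih =>
    obtain ⟨r, hr, hle⟩ : ∃ r, (r ::ₘ z ::ₘ t.verts).Nodup ∧ edge n z ⊔ t.graph r z ≤ G := by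
      simp only [verts, Multiset.nodup_cons, Multiset.mem_cons] at h ⊢
      cases c
      · exact ⟨p, by grind, (sup_le_sup_right le_sup_right _).trans hG⟩
      · exact ⟨q, by grind, (sup_le_sup_right le_sup_right _).trans hG⟩
    have hnz : G.Adj z n := hle <| by
      simp only [verts, Multiset.nodup_cons, Multiset.mem_cons, sup_adj, edge_adj] at h ⊢
      grind
    obtain ⟨w, hw, hzw⟩ := exists_adj_right hr
    have hverts : {v | v ∈ (node c z n t).verts} = {z, n} ∪ {v | v ∈ t.verts} := by
      ext; simp [verts, or_assoc]
    rw [hverts]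
    exact connected_induce_union (induce_pair_connected_of_adj hnz).preconnected
      (ih hr (le_sup_right.trans hle)).preconnected (.inl rfl) hw (hle (.inr hzw))

theorem isSide {G : SimpleGraph V} (h : (p ::ₘ q ::ₘ t.verts).Nodup) (hle : t.graph p q ≤ G)
    (hG : ∀ ⦃a b⦄, a ∈ t.verts → G.Adj a b → (t.graph p q).Adj a b) :
    IsSide G p q {v | v ∈ t.verts} where
  left_notMem hp := (Multiset.nodup_cons.1 h).1 (Multiset.mem_cons_of_mem hp)
  right_notMem := (Multiset.nodup_cons.1 (Multiset.nodup_cons.1 h).2).1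
  connected := connected_induce h hle
  mem_or_eq a b ha hab := by
    have := mem_of_adj (hG ha hab)
    grind
  exists_adj_left := (exists_adj_left h).imp fun _ ⟨hv, h⟩ => ⟨hv, hle h⟩
  exists_adj_right := (exists_adj_right h).imp fun _ ⟨hv, h⟩ => ⟨hv, hle h⟩

theorem isSplit_iSup {ι : Type*} {B : ι → Branch V} (hpq : p ≠ q)
    (hB : ∀ i, (p ::ₘ q ::ₘ (B i).verts).Nodup)
    (hdisj : Pairwise fun i j => Disjoint (B i).verts (B j).verts) :
    IsSplit (⨆ i, (B i).graph p q) ({p, q} ∪ ⋃ i, {v | v ∈ (B i).verts}) p q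
      fun i => {v | v ∈ (B i).verts} where
  ne := hpq
  not_adj h := by
    obtain ⟨i, hi⟩ := iSup_adj.1 h
    have := mem_of_adj hi
    have := hB i
    simp only [Multiset.nodup_cons, Multiset.mem_cons] at this
    grind
  side i := by
    refine isSide (hB i) (le_iSup (fun i => (B i).graph p q) i) fun a b ha hab => ?_
    obtain ⟨j, hj⟩ := iSup_adj.1 hab
    obtain rfl | hij := eq_or_ne i j
    · exact hj
    · have := Multiset.disjoint_left.1 (hdisj hij) ha
      have := mem_of_adj hj
      have := hB i
      simp only [Multiset.nodup_cons, Multiset.mem_cons] at this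
      grind
  disjoint i j hij := Set.disjoint_left.2 fun _ hi hj => Multiset.disjoint_left.1 (hdisj hij) hi hj
  cover := rfl

end Branch

section Caterpillar

variable {V : Type*}

/-- The caterpillar of triangles with root pair `x`, `y`, a vertex `m` joined to both, and two more
branches. The second branch has its poles exchanged, so that moving the root along the caterpillar
does not change any Boolean. -/
def caterpillar (x y m : V) (s t : Branch V) : SimpleGraph V :=
  (Branch.leaf m).graph x y ⊔ s.graph x y ⊔ t.graph y x

/-- The vertices of a caterpillar. -/
def caterpillarVerts (x y m : V) (s t : Branch V) : Multiset V :=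
  x ::ₘ y ::ₘ m ::ₘ (s.verts + t.verts)

theorem nodup_caterpillarVerts_iff {x y m : V} {s t : Branch V} :
    (caterpillarVerts x y m s t).Nodup ↔
      (x ::ₘ y ::ₘ (Branch.leaf m).verts).Nodup ∧ (x ::ₘ y ::ₘ s.verts).Nodup ∧
        (x ::ₘ y ::ₘ t.verts).Nodup ∧ m ∉ s.verts ∧ m ∉ t.verts ∧ Disjoint s.verts t.verts := by
  simp only [caterpillarVerts, Branch.verts, Multiset.nodup_cons, Multiset.mem_cons,
    Multiset.mem_add, Multiset.nodup_add, Multiset.mem_singleton, Multiset.nodup_singleton]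
  grind

theorem caterpillar_eq_iSup (x y m : V) (s t : Branch V) :
    caterpillar x y m s t = ⨆ i, (![.leaf m, s, t.flip] i).graph x y := by
  ext a b
  simp [caterpillar, or_assoc]

theorem caterpillarVerts_node_leaf (x y m e a b : V) (t : Branch V) :
    caterpillarVerts x y m (.node true e a (.leaf b)) t =
      a ::ₘ b ::ₘ caterpillarVerts x y m (.leaf e) t := by
  simp only [caterpillarVerts, Branch.verts, ← Multiset.singleton_add]
  ac_rfl

theorem caterpillar_node_leaf {x y m e a b : V} {t : Branch V}
    (h : (caterpillarVerts x y m (.node true e a (.leaf b)) t).Nodup) :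
    caterpillar x y m (.node true e a (.leaf b)) t =
      subdivide (caterpillar x y m (.leaf e) t) y e a b := by
  ext c d
  have := Branch.mem_of_adj (t := t) (p := y) (q := x) (a := c) (b := d)
  simp only [caterpillarVerts, Branch.verts, Multiset.nodup_cons, Multiset.mem_cons,
    Multiset.mem_add, Multiset.nodup_add, Multiset.disjoint_left, Multiset.mem_singleton] at h
  simp only [caterpillar, Branch.graph, subdivide, sup_adj, sdiff_adj, edge_adj]
  grind

/-- `G` is the caterpillar with the given data, which list each element of the vertex set `S`
exactly once. -/
structure IsCaterpillar (G : SimpleGraph V) (S : Set V) (x y m : V) (s t : Branch V) : Prop where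
  eq : G = caterpillar x y m s t
  nodup : (caterpillarVerts x y m s t).Nodup
  verts_eq : S = {v | v ∈ caterpillarVerts x y m s t}

/-- `G` is some caterpillar with vertex set `S`. -/
def HasCaterpillar (G : SimpleGraph V) (S : Set V) : Prop :=
  ∃ x y m s t, IsCaterpillar G S x y m s t

namespace IsCaterpillar

variable {G : SimpleGraph V} {S : Set V} {x y m z n e a b : V} {s t : Branch V}

theorem congr {x' y' m' : V} {s' t' : Branch V} (h : IsCaterpillar G S x y m s t)
    (hgraph : caterpillar x y m s t = caterpillar x' y' m' s' t')
    (hverts : caterpillarVerts x y m s t = caterpillarVerts x' y' m' s' t') :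
    IsCaterpillar G S x' y' m' s' t' :=
  ⟨h.eq.trans hgraph, hverts ▸ h.nodup, hverts ▸ h.verts_eq⟩

theorem swap (h : IsCaterpillar G S x y m s t) : IsCaterpillar G S y x m t s := by
  refine h.congr ?_ ?_
  · simp only [caterpillar, Branch.graph]
    ac_rfl
  · simp only [caterpillarVerts, ← Multiset.singleton_add]
    ac_rfl

theorem flip (h : IsCaterpillar G S x y m s t) : IsCaterpillar G S y x m s.flip t.flip := by
  refine h.congr ?_ ?_
  · simp only [caterpillar, Branch.graph_flip, Branch.graph, sup_comm (edge x m)]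
  · simp only [caterpillarVerts, Branch.verts_flip, Multiset.cons_swap x y]

theorem leaf_swap (h : IsCaterpillar G S x y m (.leaf e) t) :
    IsCaterpillar G S x y e (.leaf m) t := by
  refine h.congr ?_ ?_
  · simp only [caterpillar, sup_comm ((Branch.leaf m).graph x y)]
  · simp only [caterpillarVerts, Branch.verts, Multiset.singleton_add, Multiset.cons_swap m e]

theorem reroot (h : IsCaterpillar G S x y m (.node true z n s) t) :
    IsCaterpillar G S y z n s (.node true x m t) := by
  refine h.congr ?_ ?_
  · simp only [caterpillar, Branch.graph, edge_comm z x, edge_comm m x, edge_comm n z]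
    ac_rfl
  · simp only [caterpillarVerts, Branch.verts, ← Multiset.singleton_add]
    ac_rfl

theorem isSplit (h : IsCaterpillar G S x y m s t) :
    IsSplit G S x y ![{m}, {v | v ∈ s.verts}, {v | v ∈ t.verts}] := by
  obtain ⟨rfl, hn, rfl⟩ := h
  rw [caterpillar_eq_iSup]
  obtain ⟨hm, hs, ht, hms, hmt, hst⟩ := nodup_caterpillarVerts_iff.1 hn
  have hsplit := Branch.isSplit_iSup (p := x) (q := y) (B := ![.leaf m, s, t.flip])
    (by grind [Multiset.nodup_cons]) ?_ ?_
  · convert hsplit using 1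
    · ext v
      simp [caterpillarVerts, Fin.exists_fin_succ, Branch.verts, or_assoc]
    · funext i
      ext v
      fin_cases i <;> simp [Branch.verts]
  · intro i
    fin_cases i
    exacts [hm, hs, t.verts_flip.symm ▸ ht]
  · intro i j hij
    fin_cases i <;> fin_cases j <;>
      simp_all [Branch.verts, disjoint_comm]

theorem node_leaf (h : IsCaterpillar G S x y m (.leaf e) t) (ha : a ∉ S) (hb : b ∉ S)
    (hab : a ≠ b) :
    IsCaterpillar (subdivide G y e a b) (insert a (insert b S)) x y m
      (.node true e a (.leaf b)) t := by
  obtain ⟨rfl, hn, rfl⟩ := h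
  have hnodup : (caterpillarVerts x y m (.node true e a (.leaf b)) t).Nodup := by
    rw [caterpillarVerts_node_leaf]
    exact Multiset.nodup_cons.2 ⟨by simp_all, Multiset.nodup_cons.2 ⟨hb, hn⟩⟩
  refine ⟨(caterpillar_node_leaf hnodup).symm, hnodup, ?_⟩
  ext v
  simp [caterpillarVerts_node_leaf]

theorem exists_eq_subdivide (h : IsCaterpillar G S x y m (.node true e a (.leaf b)) t) :
    ∃ G' S', IsCaterpillar G' S' x y m (.leaf e) t ∧ a ∉ S' ∧ b ∉ S' ∧ a ≠ b ∧
      G = subdivide G' y e a b ∧ S = insert a (insert b S') := by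
  obtain ⟨rfl, hn, rfl⟩ := h
  have hn' := hn
  simp only [caterpillarVerts_node_leaf, Multiset.nodup_cons, Multiset.mem_cons, not_or] at hn'
  obtain ⟨⟨hab, ha⟩, hb, hn'⟩ := hn'
  refine ⟨_, _, ⟨rfl, hn', rfl⟩, ha, hb, hab, caterpillar_node_leaf hn, ?_⟩
  ext v
  simp [caterpillarVerts_node_leaf]

end IsCaterpillar

end Caterpillar

section HasCaterpillar

variable {V : Type*} {G : SimpleGraph V} {S : Set V} {x y m z n u v a b : V} {s t : Branch V}

theorem Branch.not_subsingleton_node {c : Bool} (h : (node c z n t).verts.Nodup) :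
    ¬ {v | v ∈ (node c z n t).verts}.Subsingleton := by
  intro hsub
  have hzn : z = n := hsub (by simp [verts]) (by simp [verts])
  simp [verts, hzn] at h

namespace IsCaterpillar

theorem not_hasThinSplits_of_node {c d : Bool} {z' n' : V}
    (h : IsCaterpillar G S x y m (.node c z n s) (.node d z' n' t)) (hS : G.support ⊆ S)
    (ha : a ∉ S) (hb : b ∉ S) (hab : a ≠ b) :
    ¬ HasThinSplits (subdivide G y m a b) (insert a (insert b S)) := by
  intro hthin
  obtain ⟨hm, hs, ht, -⟩ := nodup_caterpillarVerts_iff.1 h.nodup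
  have hym : G.Adj y m := by
    simp only [Branch.verts, Multiset.nodup_cons, Multiset.mem_singleton] at hm
    simp only [h.eq, caterpillar, Branch.graph, sup_adj, edge_adj]
    grind
  obtain ⟨-, i, hi⟩ := hthin (h.isSplit.update_insert (i := 0) hS hym (.inr rfl) ha hb)
  fin_cases i
  · exact hab (hi (.inl rfl) (.inr (.inl rfl)))
  · exact Branch.not_subsingleton_node (by grind [Multiset.nodup_cons]) hi
  · exact Branch.not_subsingleton_node (by grind [Multiset.nodup_cons]) hi

theorem hasCaterpillar_subdivide_right (h : IsCaterpillar G S x y m s t) (hS : G.support ⊆ S)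
    (ha : a ∉ S) (hb : b ∉ S) (hab : a ≠ b) (huv : (edge y m).Adj u v)
    (hthin : HasThinSplits (subdivide G u v a b) (insert a (insert b S))) :
    HasCaterpillar (subdivide G u v a b) (insert a (insert b S)) := by
  rw [subdivide_congr G ((adj_edge y m).1 huv).1.symm] at hthin ⊢
  rcases s with e | ⟨c, z, n, s⟩
  · exact ⟨_, _, _, _, _, h.leaf_swap.node_leaf ha hb hab⟩
  rcases t with e | ⟨d, z', n', t⟩
  · have h' : IsCaterpillar G S x y m (.leaf e) _ := h.swap.flip
    exact ⟨_, _, _, _, _, h'.leaf_swap.node_leaf ha hb hab⟩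
  · exact absurd hthin (h.not_hasThinSplits_of_node hS ha hb hab)

theorem not_hasThinSplits_left (h : IsCaterpillar G S x y m (.node true z n s) t)
    (hS : G.support ⊆ S) (ha : a ∉ S) (hb : b ∉ S) (hab : a ≠ b) (huv : (edge x z).Adj u v) :
    ¬ HasThinSplits (subdivide G u v a b) (insert a (insert b S)) := by
  rw [subdivide_congr G ((adj_edge x z).1 huv).1.symm]
  intro hthin
  obtain ⟨-, hs, -⟩ := nodup_caterpillarVerts_iff.1 h.nodup
  simp only [Branch.verts, Multiset.nodup_cons, Multiset.mem_cons] at hs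
  obtain ⟨w, hw, hyw⟩ := Branch.exists_adj_left (t := s) (p := y) (q := z)
    (by simp only [Multiset.nodup_cons, Multiset.mem_cons]; grind)
  have hle : (Branch.node true z n s).graph x y ≤ G :=
    h.eq ▸ le_sup_right.trans le_sup_left
  have hxz : G.Adj x z := hle (by simp only [Branch.graph, sup_adj, edge_adj]; grind)
  have hyn : G.Adj y n := hle (by simp only [Branch.graph, sup_adj, edge_adj]; grind)
  have hyw : G.Adj y w := hle (.inr hyw)
  obtain ⟨hdeg, -⟩ := hthin (h.isSplit.update_insert (i := 1) hS hxz
    (.inr (Multiset.mem_cons_self ..)) ha hb)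
  have hxa := subdivide_adj_of_mem (G := G) (u := x) (v := z) (c := x) (a := a) (b := b)
    (.inl rfl) (fun h => ha (h ▸ hS ⟨z, hxz⟩)) (fun h => hb (h ▸ hS ⟨z, hxz⟩))
  rcases hdeg 1 with hx | hy
  · exact hab (hx ⟨.inl rfl, hxa.1⟩ ⟨.inr (.inl rfl), hxa.2⟩)
  · have hwn : w = n := hy
      ⟨.inr (.inr (by simp [Branch.verts, hw])), subdivide_adj_of_adj hyw (by grind)⟩
      ⟨.inr (.inr (by simp [Branch.verts])), subdivide_adj_of_adj hyn (by grind)⟩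
    grind

theorem hasCaterpillar_subdivide_branch (h : IsCaterpillar G S x y m s t) (hS : G.support ⊆ S)
    (ha : a ∉ S) (hb : b ∉ S) (hab : a ≠ b) (huv : (s.graph x y).Adj u v)
    (hthin : HasThinSplits (subdivide G u v a b) (insert a (insert b S))) :
    HasCaterpillar (subdivide G u v a b) (insert a (insert b S)) := by
  induction s generalizing x y m t with
  | leaf e =>
    rcases huv with huv | huv
    · exact h.leaf_swap.flip.hasCaterpillar_subdivide_right hS ha hb hab huv hthin
    · exact h.leaf_swap.hasCaterpillar_subdivide_right hS ha hb hab huv hthin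
  | node c z n s ih =>
    wlog hc : c = true generalizing x y t c
    · obtain rfl : c = false := by simpa using hc
      exact this true h.flip (by simpa [Branch.graph] using huv) rfl
    subst hc
    rcases huv with ((huv | huv) | huv) | huv
    · exact absurd hthin (h.not_hasThinSplits_left hS ha hb hab huv)
    · exact h.reroot.flip.hasCaterpillar_subdivide_right hS ha hb hab huv hthin
    · exact h.reroot.hasCaterpillar_subdivide_right hS ha hb hab (edge_comm n z ▸ huv) hthin
    · exact ih h.reroot huv

theorem hasCaterpillar_subdivide (h : IsCaterpillar G S x y m s t) (hS : G.support ⊆ S)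
    (ha : a ∉ S) (hb : b ∉ S) (hab : a ≠ b) (huv : G.Adj u v)
    (hthin : HasThinSplits (subdivide G u v a b) (insert a (insert b S))) :
    HasCaterpillar (subdivide G u v a b) (insert a (insert b S)) := by
  have huv' := h.eq ▸ huv
  rcases huv' with ((huv | huv) | huv) | huv
  · exact h.flip.hasCaterpillar_subdivide_right hS ha hb hab huv hthin
  · exact h.hasCaterpillar_subdivide_right hS ha hb hab huv hthin
  · exact h.hasCaterpillar_subdivide_branch hS ha hb hab huv hthin
  · exact h.swap.hasCaterpillar_subdivide_branch hS ha hb hab huv hthin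

end IsCaterpillar

theorem spanningCoe_top_adj {a b : V} :
    (⊤ : SimpleGraph S).spanningCoe.Adj a b ↔ a ∈ S ∧ b ∈ S ∧ a ≠ b := by
  simp only [map_adj, top_adj, Function.Embedding.subtype_apply, Subtype.exists, Subtype.mk.injEq,
    ne_eq]
  grind

theorem isCaterpillar_subdivide_triangle (h : (x ::ₘ y ::ₘ m ::ₘ {a, b}).Nodup) :
    IsCaterpillar (subdivide (⊤ : SimpleGraph ({x, y, m} : Set V)).spanningCoe x y a b)
      (insert a (insert b {x, y, m})) x y m (.leaf a) (.leaf b) := by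
  refine ⟨?_, h, ?_⟩
  · ext c d
    simp only [Multiset.nodup_cons, Multiset.mem_cons, Multiset.insert_eq_cons,
      Multiset.mem_singleton] at h
    simp only [subdivide, caterpillar, Branch.graph, sup_adj, sdiff_adj, edge_adj,
      spanningCoe_top_adj]
    grind
  · ext c
    simp only [caterpillarVerts, Branch.verts, Multiset.mem_cons, Multiset.mem_add,
      Multiset.mem_singleton, Set.mem_insert_iff, Set.mem_singleton_iff, Set.mem_ofPred_eq]
    grind

theorem eq_triangle_or_hasCaterpillar {V : Type u} {G : SimpleGraph V} {S : Set V}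
    (h : IsGeneralisedTriangleOn G S) (hthin : HasThinSplits G S) :
    (S.ncard = 3 ∧ G = (⊤ : SimpleGraph S).spanningCoe) ∨ HasCaterpillar G S := by
  induction h with
  | triangle hS => exact .inl ⟨hS, rfl⟩
  | @step G S u v a b hG huv ha hb hab ih =>
    right
    rcases ih (hthin.of_subdivide hG.support_subset huv ha hb hab) with ⟨hS, rfl⟩ | h
    · obtain ⟨huS, hvS, hne⟩ := spanningCoe_top_adj.1 huv
      have hcard : (S \ {u, v}).ncard = 1 := by
        rw [Set.ncard_sdiff (Set.pair_subset huS hvS), hS, Set.ncard_pair hne]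
      obtain ⟨w, hw⟩ := Set.ncard_eq_one.1 hcard
      obtain ⟨⟨hwS, hwu⟩, hSw⟩ := Set.eq_singleton_iff_unique_mem.1 hw
      obtain rfl : S = {u, v, w} := by ext; grind
      refine ⟨_, _, _, _, _, isCaterpillar_subdivide_triangle (m := w) ?_⟩
      simp only [Multiset.nodup_cons, Multiset.mem_cons, Multiset.insert_eq_cons,
        Multiset.mem_singleton, Multiset.nodup_singleton]
      grind
    · obtain ⟨x, y, m, s, t, h⟩ := h
      exact h.hasCaterpillar_subdivide hG.support_subset ha hb hab huv hthin

end HasCaterpillar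

namespace IsCaterpillar

variable {V : Type u} {G : SimpleGraph V} {S : Set V} {x y m e : V} {s t : Branch V}

theorem adj_right_leaf (h : IsCaterpillar G S x y m (.leaf e) t) : G.Adj y e := by
  have hn := h.nodup
  simp only [caterpillarVerts, Branch.verts, Multiset.nodup_cons, Multiset.mem_cons,
    Multiset.mem_add, Multiset.mem_singleton] at hn
  simp only [h.eq, caterpillar, Branch.graph, sup_adj, edge_adj]
  grind

theorem isGeneralisedTriangleOn_leaf_leaf {e' : V}
    (h : IsCaterpillar G S x y m (.leaf e) (.leaf e')) : IsGeneralisedTriangleOn G S := by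
  have hn : (x ::ₘ y ::ₘ m ::ₘ {e, e'}).Nodup := h.nodup
  have h' := isCaterpillar_subdivide_triangle hn
  rw [h.eq.trans h'.eq.symm, h.verts_eq.trans h'.verts_eq.symm]
  simp only [Multiset.nodup_cons, Multiset.mem_cons, Multiset.insert_eq_cons,
    Multiset.mem_singleton] at hn
  refine .step (.triangle (Set.ncard_eq_three.2 ⟨x, y, m, ?_⟩)) (spanningCoe_top_adj.2 ?_) ?_ ?_ ?_
  all_goals grind

theorem isGeneralisedTriangleOn (h : IsCaterpillar G S x y m (.leaf e) t) :
    IsGeneralisedTriangleOn G S := by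
  induction t generalizing G S x y m e with
  | leaf e' => exact h.isGeneralisedTriangleOn_leaf_leaf
  | node c z n t ih =>
    wlog hc : c = true generalizing x y c
    · obtain rfl : c = false := by simpa using hc
      exact this true h.flip rfl
    subst hc
    have h' : IsCaterpillar G S z x n (.node true y m (.leaf e)) t := h.swap.reroot.swap
    obtain ⟨G', S', hG', hm, he, hme, rfl, rfl⟩ := h'.exists_eq_subdivide
    exact .step (ih hG') hG'.adj_right_leaf hm he hme

theorem exists_leaf (h : IsCaterpillar G S x y m s t) :
    ∃ x y m e t, IsCaterpillar G S x y m (.leaf e) t := by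
  induction s generalizing x y m t with
  | leaf e => exact ⟨_, _, _, _, _, h⟩
  | node b z n s ih =>
    cases b
    · exact ih h.flip.reroot
    · exact ih h.reroot

end IsCaterpillar

section Switch

variable {V : Type u} {G : SimpleGraph V} {x y : V}

namespace CutComponent

variable {C : G.CutComponent x y} {a b : V}

theorem switch_adj_of_mem_iff_mem
    (h : a ∈ CutComponent.verts C ↔ b ∈ CutComponent.verts C) :
    (CutComponent.switch C).Adj a b ↔ G.Adj a b := by
  have := left_notMem_verts C
  have := right_notMem_verts C
  simp only [CutComponent.switch, fromRel_adj]
  grind [G.ne_of_adj, G.adj_comm a b]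

theorem switch_adj_left (ha : a ∈ CutComponent.verts C) :
    (CutComponent.switch C).Adj a x ↔ G.Adj a y := by
  have := left_notMem_verts C
  have := right_notMem_verts C
  simp only [CutComponent.switch, fromRel_adj]
  grind

theorem switch_adj_right (ha : a ∈ CutComponent.verts C) :
    (CutComponent.switch C).Adj a y ↔ G.Adj a x := by
  have := left_notMem_verts C
  have := right_notMem_verts C
  simp only [CutComponent.switch, fromRel_adj]
  grind

theorem mem_verts_of_switch_adj (ha : a ∈ CutComponent.verts C)
    (hab : (CutComponent.switch C).Adj a b) : b ∈ CutComponent.verts C ∨ b = x ∨ b = y := by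
  have := left_notMem_verts C
  have := right_notMem_verts C
  simp only [CutComponent.switch, fromRel_adj] at hab
  grind

theorem switch_eq_of_sup [DecidableEq V] {A B : SimpleGraph V} (hG : G = A ⊔ B)
    (hA : ∀ ⦃a b⦄, A.Adj a b → a ∉ CutComponent.verts C)
    (hB : ∀ ⦃a b⦄, B.Adj a b → a ∈ CutComponent.verts C ∨ b ∈ CutComponent.verts C) :
    CutComponent.switch C = A ⊔ B.map (Equiv.swap x y) := by
  have hmap (a b) : (B.map (Equiv.swap x y)).Adj a b ↔
      B.Adj (Equiv.swap x y a) (Equiv.swap x y b) := by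
    simpa using (Iso.map (Equiv.swap x y) B).map_adj_iff (v := Equiv.swap x y a)
      (w := Equiv.swap x y b)
  have hx := left_notMem_verts C
  have hy := right_notMem_verts C
  have hfix {a} (ha : a ∈ CutComponent.verts C) : Equiv.swap x y a = a :=
    Equiv.swap_apply_of_ne_of_ne (ne_of_mem_of_not_mem ha hx) (ne_of_mem_of_not_mem ha hy)
  have hswap (a) : Equiv.swap x y a ∈ CutComponent.verts C ↔ a ∈ CutComponent.verts C := by
    grind
  have hAB {a b} : G.Adj a b ↔ A.Adj a b ∨ B.Adj a b := by rw [hG, sup_adj]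
  have hout {a b} (ha : a ∈ CutComponent.verts C) (hb : b ∉ CutComponent.verts C) :
      (CutComponent.switch C).Adj a b ↔ (A ⊔ B.map (Equiv.swap x y)).Adj a b := by
    rw [sup_adj, hmap, hfix ha]
    have hBG {b} : B.Adj a b ↔ G.Adj a b := by grind
    by_cases hbx : b = x
    · rw [hbx, switch_adj_left ha, Equiv.swap_apply_left, hBG]
      grind
    by_cases hby : b = y
    · rw [hby, switch_adj_right ha, Equiv.swap_apply_right, hBG]
      grind
    · rw [Equiv.swap_apply_of_ne_of_ne hbx hby, hBG]
      have := mem_verts_of_adj ha (b := b)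
      have := mem_verts_of_switch_adj ha (b := b)
      grind
  ext a b
  by_cases ha : a ∈ CutComponent.verts C <;> by_cases hb : b ∈ CutComponent.verts C
  · rw [switch_adj_of_mem_iff_mem (by grind), sup_adj, hmap, hfix ha, hfix hb, hAB]
  · exact hout ha hb
  · rw [adj_comm, hout hb ha, adj_comm]
  · rw [switch_adj_of_mem_iff_mem (by grind), sup_adj, hmap, hAB]
    grind

end CutComponent

end Switch

section Recolor

variable {V α : Type*} {G : SimpleGraph V} {x y : V} {A : Set V}

theorem forall_adj_ne_iff (hA : ∀ ⦃a b⦄, a ∈ A → G.Adj a b → b ∈ A ∨ b = x ∨ b = y)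
    (c : V → α) :
    (∀ a b, G.Adj a b → c a ≠ c b) ↔
      (∀ a b, (a ∈ A ↔ b ∈ A) → G.Adj a b → c a ≠ c b) ∧
        (∀ a ∈ A, G.Adj a x → c a ≠ c x) ∧ ∀ a ∈ A, G.Adj a y → c a ≠ c y := by
  refine ⟨fun h => ⟨fun a b _ => h a b, fun a _ => h a x, fun a _ => h a y⟩, ?_⟩
  rintro ⟨hmem, hleft, hright⟩ a b hab
  grind [G.adj_comm a b]

open Classical in
/-- The colouring obtained from `c` by exchanging the colours of `x` and `y` on the set `A`. -/
noncomputable def recolor (A : Set V) (x y : V) (c : V → α) : V → α :=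
  A.piecewise (Equiv.swap (c x) (c y) ∘ c) c

variable {a b : V} {c : V → α}

theorem recolor_of_notMem (ha : a ∉ A) : recolor A x y c a = c a := by
  classical exact A.piecewise_eq_of_notMem _ _ ha

open Classical in
theorem recolor_of_mem (ha : a ∈ A) : recolor A x y c a = Equiv.swap (c x) (c y) (c a) :=
  A.piecewise_eq_of_mem _ _ ha

theorem recolor_recolor (hx : x ∉ A) (hy : y ∉ A) :
    recolor A x y (recolor A x y c) = c := by
  classical
  funext a
  by_cases ha : a ∈ A
  · rw [recolor_of_mem ha, recolor_of_mem ha, recolor_of_notMem hx, recolor_of_notMem hy,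
      Equiv.swap_apply_self]
  · rw [recolor_of_notMem ha, recolor_of_notMem ha]

theorem recolor_eq_left_iff (hx : x ∉ A) (ha : a ∈ A) :
    recolor A x y c a = recolor A x y c x ↔ c a = c y := by
  classical
  rw [recolor_of_mem ha, recolor_of_notMem hx, Equiv.swap_apply_eq_iff, Equiv.swap_apply_left]

theorem recolor_eq_right_iff (hy : y ∉ A) (ha : a ∈ A) :
    recolor A x y c a = recolor A x y c y ↔ c a = c x := by
  classical
  rw [recolor_of_mem ha, recolor_of_notMem hy, Equiv.swap_apply_eq_iff, Equiv.swap_apply_right]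

theorem recolor_eq_recolor_iff (h : a ∈ A ↔ b ∈ A) :
    recolor A x y c a = recolor A x y c b ↔ c a = c b := by
  classical
  by_cases ha : a ∈ A
  · rw [recolor_of_mem ha, recolor_of_mem (h.1 ha), (Equiv.swap _ _).injective.eq_iff]
  · rw [recolor_of_notMem ha, recolor_of_notMem (mt h.2 ha)]

end Recolor

section ChromaticPolynomial

variable {V : Type u} {α : Type*} {G H : SimpleGraph V} {x y : V}

theorem CutComponent.forall_switch_adj_recolor_ne_iff (C : G.CutComponent x y) (c : V → α) :
    (∀ a b, (CutComponent.switch C).Adj a b →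
      recolor (CutComponent.verts C) x y c a ≠ recolor (CutComponent.verts C) x y c b) ↔
        ∀ a b, G.Adj a b → c a ≠ c b := by
  have hx := left_notMem_verts C
  have hy := right_notMem_verts C
  rw [forall_adj_ne_iff fun _ _ => mem_verts_of_switch_adj,
    forall_adj_ne_iff (A := CutComponent.verts C) fun _ _ => mem_verts_of_adj]
  refine and_congr ?_ (and_comm.trans (and_congr ?_ ?_))
  · refine forall₃_congr fun a b h => ?_
    rw [switch_adj_of_mem_iff_mem h, Ne, recolor_eq_recolor_iff h]
  · refine forall₂_congr fun a ha => ?_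
    rw [switch_adj_right ha, Ne, recolor_eq_right_iff hy ha]
  · refine forall₂_congr fun a ha => ?_
    rw [switch_adj_left ha, Ne, recolor_eq_left_iff hx ha]

theorem CutComponent.card_coloring_switch (C : G.CutComponent x y) (α : Type*) :
    Nat.card ((CutComponent.switch C).Coloring α) = Nat.card (G.Coloring α) := by
  have hrec (c : V → α) := recolor_recolor (c := c) (left_notMem_verts C) (right_notMem_verts C)
  refine Nat.card_congr
    { toFun c := Coloring.mk (recolor (CutComponent.verts C) x y c) fun {a b} hab =>
        (forall_switch_adj_recolor_ne_iff C _).1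
          ((hrec c).symm ▸ fun _ _ => c.valid) a b hab
      invFun c := Coloring.mk (recolor (CutComponent.verts C) x y c) fun {a b} hab =>
        (forall_switch_adj_recolor_ne_iff C c).2 (fun _ _ => c.valid) a b hab
      left_inv c := DFunLike.coe_injective (hrec c)
      right_inv c := DFunLike.coe_injective (hrec c) }

theorem chromaticPolynomial_congr [Finite V]
    (h : ∀ n, Nat.card (G.Coloring (Fin n)) = Nat.card (H.Coloring (Fin n))) :
    G.chromaticPolynomial = H.chromaticPolynomial :=
  (existsUnique_chromaticPolynomial H).unique
    (fun n => by rw [chromaticPolynomial_eval, h]) (chromaticPolynomial_eval H)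

theorem chromaticPolynomial_eq_of_reflTransGen [Finite V]
    (h : Relation.ReflTransGen IsWhitneySwitch G H) :
    G.chromaticPolynomial = H.chromaticPolynomial := by
  induction h with
  | refl => rfl
  | tail _ hs ih =>
    obtain ⟨x, y, -, C, rfl⟩ := hs
    exact ih.trans <| chromaticPolynomial_congr fun n =>
      (CutComponent.card_coloring_switch C (Fin n)).symm

end ChromaticPolynomial

section HamiltonianPath

variable {V : Type u} {G : SimpleGraph V} {S : Set V} {x y m e p q : V} {s t : Branch V}

theorem IsCaterpillar.flip_left (h : IsCaterpillar G S x y m s t) :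
    IsCaterpillar (caterpillar x y m s.flip t) S x y m s.flip t where
  eq := rfl
  nodup := by simpa only [caterpillarVerts, Branch.verts_flip] using h.nodup
  verts_eq := by simpa only [caterpillarVerts, Branch.verts_flip] using h.verts_eq

theorem IsCaterpillar.isWhitneySwitch [Finite V] (h : IsCaterpillar G Set.univ x y m s t) :
    IsWhitneySwitch G (caterpillar x y m s.flip t) := by
  classical
  obtain ⟨C, hC⟩ := (h.isSplit.side 1).exists_verts_eq
  replace hC : CutComponent.verts C = {v | v ∈ s.verts} := hC
  obtain ⟨-, hs, -, hms, -, hst⟩ := nodup_caterpillarVerts_iff.1 h.nodup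
  rw [Multiset.disjoint_left] at hst
  have ⟨hx, hy⟩ : x ∉ s.verts ∧ y ∉ s.verts := by grind [Multiset.nodup_cons]
  refine ⟨x, y, h.isSplit.isTwoCut, C, ?_⟩
  rw [CutComponent.switch_eq_of_sup (A := (Branch.leaf m).graph x y ⊔ t.graph y x)
    (B := s.graph x y)]
  · rw [Branch.map_swap_graph hs, caterpillar]
    ac_rfl
  · rw [h.eq, caterpillar]
    ac_rfl
  · intro a b hab
    rw [hC]
    rcases hab with hab | hab
    · have := Branch.mem_of_adj hab
      simp only [Branch.verts, Multiset.mem_singleton] at this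
      grind
    · have := Branch.mem_of_adj hab
      grind
  · intro a b hab
    rw [hC]
    exact (Branch.mem_of_adj hab).imp And.left And.left

theorem IsCaterpillar.exists_zigzag [Finite V] (h : IsCaterpillar G Set.univ x y m s t)
    (ht : t.IsZigzag) :
    ∃ H x y m e t, Relation.ReflTransGen IsWhitneySwitch G H ∧
      IsCaterpillar H Set.univ x y m (.leaf e) t ∧ t.IsZigzag := by
  induction s generalizing G x y m t with
  | leaf e => exact ⟨G, _, _, _, _, _, .refl, h, ht⟩
  | node b z n s ih =>
    cases b
    · obtain ⟨H, x, y, m, e, t, hGH, hH⟩ := ih h.flip_left.reroot ⟨rfl, ht⟩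
      exact ⟨H, x, y, m, e, t, .head h.isWhitneySwitch hGH, hH⟩
    · exact ih h.reroot ⟨rfl, ht⟩

namespace Branch

/-- The vertices of a branch in the order in which a Hamiltonian path of a zigzag visits them,
coming from the second pole. -/
def path : Branch V → List V
  | leaf e => [e]
  | node _ z n t => n :: z :: t.path

theorem coe_path (t : Branch V) : (t.path : Multiset V) = t.verts := by
  induction t with
  | leaf e => rfl
  | node b z n t ih =>
    rw [verts, ← ih, Multiset.cons_swap]
    rfl

theorem isChain_path (ht : t.IsZigzag) (hG : t.graph p q ≤ G) (hn : (q ::ₘ t.verts).Nodup) :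
    (q :: t.path).IsChain G.Adj := by
  induction t generalizing p q with
  | leaf e =>
    simp only [verts, Multiset.nodup_cons, Multiset.mem_singleton] at hn
    simp only [path, List.isChain_cons_cons, List.isChain_singleton, and_true]
    exact hG (by simp only [graph, sup_adj, edge_adj]; grind)
  | node b z n t ih =>
    obtain ⟨rfl, ht⟩ := ht
    simp only [verts, Multiset.nodup_cons, Multiset.mem_cons] at hn
    refine .cons_cons (hG ?_) (.cons_cons (hG ?_) (ih ht (le_sup_right.trans hG) ?_))
    · simp only [graph, sup_adj, edge_adj]
      grind
    · simp only [graph, sup_adj, edge_adj]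
      grind
    · exact Multiset.nodup_cons.2 (by grind)

end Branch

theorem hasHamiltonianPath_of_isChain {l : List V} (hne : l ≠ []) (hchain : l.IsChain G.Adj)
    (hnodup : l.Nodup) (hmem : ∀ v, v ∈ l) : G.HasHamiltonianPath := by
  classical
  refine ⟨_, _, Walk.ofSupport l hne hchain, fun v => ?_⟩
  rw [Walk.support_ofSupport]
  convert List.count_eq_one_of_mem hnodup (hmem v)

theorem IsCaterpillar.hasHamiltonianPath (h : IsCaterpillar G Set.univ x y m (.leaf e) t)
    (ht : t.IsZigzag) : G.HasHamiltonianPath := by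
  obtain ⟨rfl, hn, hS⟩ := h
  have hverts : ((e :: y :: m :: x :: t.path : List V) : Multiset V) =
      caterpillarVerts x y m (.leaf e) t := by
    simp only [← Multiset.cons_coe, t.coe_path, caterpillarVerts, Branch.verts,
      ← Multiset.singleton_add]
    ac_rfl
  refine hasHamiltonianPath_of_isChain (l := e :: y :: m :: x :: t.path) (by simp) ?_ ?_ ?_
  · simp only [caterpillarVerts, Branch.verts, Multiset.nodup_cons, Multiset.mem_cons,
      Multiset.singleton_add] at hn
    refine .cons_cons ?_ (.cons_cons ?_ (.cons_cons ?_
      (Branch.isChain_path ht le_sup_right (Multiset.nodup_cons.2 (by grind)))))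
    all_goals
      simp only [caterpillar, Branch.graph, sup_adj, edge_adj]
      grind
  · rwa [← Multiset.coe_nodup, hverts]
  · intro v
    rw [← Multiset.mem_coe, hverts]
    exact hS.subset (Set.mem_univ v)

theorem hasHamiltonianPath_of_ncard_eq_three (h : (Set.univ : Set V).ncard = 3) :
    (⊤ : SimpleGraph (Set.univ : Set V)).spanningCoe.HasHamiltonianPath := by
  obtain ⟨a, b, c, hab, hac, hbc, huniv⟩ := Set.ncard_eq_three.1 h
  refine hasHamiltonianPath_of_isChain (l := [a, b, c]) (by simp) (by simp [hab, hbc])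
    (by simp [hab, hac, hbc]) fun v => ?_
  simpa using huniv.subset (Set.mem_univ v)

end HamiltonianPath

end GeneralisedTriangle

open GeneralisedTriangle in
theorem lemma22 {V : Type*} [Finite V] (G : SimpleGraph V) (h₁ : G.MemK₁) (h₂ : G.MemK₂) :
    ∃ H : SimpleGraph V,
      Relation.ReflTransGen SimpleGraph.IsWhitneySwitch G H ∧
      H.IsGeneralisedTriangle ∧ H.HasHamiltonianPath ∧
      G.chromaticPolynomial = H.chromaticPolynomial := by
  have hG := isGeneralisedTriangleOn_univ_iff.2 h₁.1
  rcases eq_triangle_or_hasCaterpillar hG (hasThinSplits_univ h₁ h₂) with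
    ⟨hcard, rfl⟩ | ⟨x, y, m, s, t, h⟩
  · exact ⟨_, .refl, h₁.1, hasHamiltonianPath_of_ncard_eq_three hcard, rfl⟩
  · obtain ⟨x, y, m, e, t, h⟩ := h.exists_leaf
    obtain ⟨H, x, y, m, e', t', hGH, hH, ht⟩ := h.swap.exists_zigzag (t := .leaf e) trivial
    exact ⟨H, hGH, isGeneralisedTriangleOn_univ_iff.1 hH.isGeneralisedTriangleOn,
      hH.hasHamiltonianPath ht, chromaticPolynomial_eq_of_reflTransGen hGH⟩
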